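/- Let $K$ be a field of characteristic zero, let $n\ge 0$, and let $S_n$ act on $K[V\oplus V]=K[x_1,\dots,x_n,y_1,\dots,y_n]$ by $\sigma\cdot x_i=x_{\sigma(i)}$, $\sigma\cdot y_i=y_{\sigma(i)}$, where $V=K^n$ is the permutation representation. Take as primary invariants the $2n$ power sums $L_m=\sum_{i=1}^n x_i^m$ and $R_m=\sum_{i=1}^n y_i^m$, $1\le m\le n$, and put $F=K[L_1,\dots,L_n,R_1,\dots,R_n]$. A set of secondary invariants is a set of homogeneous polynomials that is a basis of the invariant ring $K[V\oplus V]^{S_n}$ as an $F$-module. Then $L_1,\dots,L_n,R_1,\dots,R_n$ are algebraically independent over $K$, a set of secondary invariants exists, and every set of secondary invariants has exactly $n!$ elements, the highest degree of an element being $n(n-1)$. -/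

import Mathlib

/-- The invariant ring `K[V ⊕ V]^{S_n}`, where `V = K^n` is the permutation representation of `S_n`.
The coordinate ring `K[V ⊕ V]` is the polynomial ring in `x_i = X (Sum.inl i)` and
`y_i = X (Sum.inr i)`, and `σ` acts diagonally, by `x_i ↦ x_{σ i}` and `y_i ↦ y_{σ i}`. -/
def diagonalInvariants (K : Type*) [Field K] (n : ℕ) :
    Subalgebra K (MvPolynomial (Fin n ⊕ Fin n) K) where
  carrier := {f | ∀ σ : Equiv.Perm (Fin n), MvPolynomial.rename (Sum.map σ σ) f = f}
  mul_mem' := fun ha hb σ => by rw [map_mul, ha σ, hb σ]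
  add_mem' := fun ha hb σ => by rw [map_add, ha σ, hb σ]
  algebraMap_mem' := fun r σ => by rw [AlgHom.commutes]

/-- The unmixed power sums `x_1^m + ⋯ + x_n^m` and `y_1^m + ⋯ + y_n^m`, for `1 ≤ m ≤ n`
(the index `m : Fin n` stands for the exponent `m + 1`). -/
noncomputable def unmixedPowerSum (K : Type*) [Field K] (n : ℕ) :
    Fin n ⊕ Fin n → MvPolynomial (Fin n ⊕ Fin n) K
  | Sum.inl m => ∑ i : Fin n, MvPolynomial.X (Sum.inl i) ^ ((m : ℕ) + 1)
  | Sum.inr m => ∑ i : Fin n, MvPolynomial.X (Sum.inr i) ^ ((m : ℕ) + 1)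

/-- A Hironaka decomposition of a subalgebra `A` of a polynomial ring over `K`: the family `θ`
(the primary invariants) consists of homogeneous, algebraically independent elements of `A`, and
the set `S` (the secondary invariants) consists of homogeneous polynomials and is a basis of `A`
as a module over the polynomial ring `K[θ]`. -/
structure IsHironakaDecomposition {K τ ι : Type*} [Field K]
    (A : Subalgebra K (MvPolynomial τ K)) (θ : ι → MvPolynomial τ K)
    (S : Set (MvPolynomial τ K)) : Prop where
  primary_mem : ∀ i, θ i ∈ A
  primary_homogeneous : ∀ i, ∃ d : ℕ, (θ i).IsHomogeneous d
  primary_algebraicIndependent : AlgebraicIndependent K θ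
  secondary_homogeneous : ∀ g ∈ S, ∃ d : ℕ, g.IsHomogeneous d
  secondary_linearIndependent : LinearIndepOn (Algebra.adjoin K (Set.range θ)) id S
  secondary_span :
    (Submodule.span (Algebra.adjoin K (Set.range θ)) S : Set (MvPolynomial τ K)) = A

/-! Write A for the polynomial ring, P for `powerSumAlgebra`, M for the invariants and I for the
ideal of A generated by the power sums. By Newton's identities the x_i are the roots of a monic
polynomial over P, and so are the y_i; hence A is spanned over P by the (n!)^2 monomials x^a y^b
with a_i, b_i ≤ i (indices from 0). As S_n × S_n fixes P, the rank of A over P is a multiple of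
(n!)^2, hence equal to it. Finiteness gives algebraic independence by transcendence degree. Since A
has rank n! over M, M has rank n! over P.

Existence: a homogeneous basis of A/I is lifted compatibly with the Reynolds projection. By graded
Nakayama and the rank count the lift is a P-basis of A, and its part fixed by the projection is a
basis of M (`exists_homogeneous_basis_range`).

Degrees: modulo I, P acts through constant terms, so a homogeneous element lies in I unless some
P-generator shares its degree. The generators of A have degree ≤ n(n-1), and by the Reynolds
operator no secondary invariant lies in I: this is the upper bound. Conversely, the orbit sum of ∏
x_i^i y_i^i is an invariant of degree n(n-1) outside I, as antisymmetrization over S_n × S_n shows,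
so some secondary invariant has that degree. -/

/-! ### Ranks over fixed rings and in towers -/

section Rank

open Module

/-- Galois theory: G acts faithfully because ρ is injective, and M is exactly its fixed ring. -/
theorem finrank_fixed_eq_card {K τ G : Type*} [Field K] [Group G] [Finite G]
    (ρ : G →* Equiv.Perm τ) (hρ : Function.Injective ρ) (M : Subalgebra K (MvPolynomial τ K))
    (hM : ∀ f, f ∈ M ↔ ∀ g, MvPolynomial.rename (ρ g) f = f) :
    finrank M (MvPolynomial τ K) = Nat.card G := by
  let : MulSemiringAction G (MvPolynomial τ K) :=
    { smul := fun g f => MvPolynomial.rename (ρ g) f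
      one_smul := fun f => by
        change MvPolynomial.rename (ρ 1) f = f
        rw [map_one]; exact MvPolynomial.rename_id_apply f
      mul_smul := fun g h f => by
        change MvPolynomial.rename (ρ (g * h)) f
          = MvPolynomial.rename (ρ g) (MvPolynomial.rename (ρ h) f)
        rw [MvPolynomial.rename_rename, map_mul]; rfl
      smul_zero := fun g => map_zero _
      smul_add := fun g => map_add _
      smul_one := fun g => map_one _
      smul_mul := fun g => map_mul _ }
  have hs : ∀ (g : G) (f : MvPolynomial τ K), g • f = MvPolynomial.rename (ρ g) f := fun _ _ => rfl
  have : IsGaloisGroup G M (MvPolynomial τ K) :=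
    { faithful := ⟨fun {g h} H => hρ <| Equiv.ext fun i => by
        simpa [hs] using H (MvPolynomial.X i)⟩
      commutes := ⟨fun g m f => by
        rw [Subalgebra.smul_def, Subalgebra.smul_def, smul_eq_mul, smul_eq_mul, hs, hs, map_mul,
          (hM m).1 m.2 g]⟩
      isInvariant := ⟨fun f hf => ⟨⟨f, (hM f).2 hf⟩, rfl⟩⟩ }
  exact (IsGaloisGroup.card_eq_finrank' G M (MvPolynomial τ K)).symm

theorem finrank_mul_finrank_of_coe_eq {K A : Type*} [Field K] [CommRing A] [IsDomain A]
    [Algebra K A] (P M : Subalgebra K A) (h : P ≤ M) (N : Submodule P A)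
    (hN : (N : Set A) = M) : finrank P N * finrank M A = finrank P A := by
  let _ : Algebra P M := (Subalgebra.inclusion h).toAlgebra
  have : IsScalarTower P M A := .of_algebraMap_eq fun _ => rfl
  have hmem : ∀ a, a ∈ N ↔ a ∈ M := fun a => Set.ext_iff.1 hN a
  let e : N ≃ₗ[P] M :=
    { toFun := fun a => ⟨a, (hmem _).1 a.2⟩
      invFun := fun a => ⟨a, (hmem _).2 a.2⟩
      map_add' := fun _ _ => rfl
      map_smul' := fun _ _ => rfl
      left_inv := fun _ => rfl
      right_inv := fun _ => rfl }
  rw [e.finrank_eq]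
  exact finrank_mul_finrank' A

end Rank

/-! ### Artin's staircase spanning set -/

section Staircase

open Polynomial Pointwise

/-- Exponents lying weakly under the staircase `0, 1, …, n - 1`. -/
def staircase (n : ℕ) : Finset (Fin n → ℕ) :=
  Fintype.piFinset fun i => Finset.range ((i : ℕ) + 1)

theorem mem_staircase {n : ℕ} {a : Fin n → ℕ} : a ∈ staircase n ↔ ∀ i, a i ≤ i := by
  simp [staircase, Fintype.mem_piFinset]

theorem card_staircase (n : ℕ) : (staircase n).card = n.factorial := by
  rw [staircase, Fintype.card_piFinset]
  simp only [Finset.card_range]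
  rw [Fin.prod_univ_eq_prod_range (fun i => i + 1) n, Finset.prod_range_add_one_eq_factorial]

theorem sum_le_of_mem_staircase {n : ℕ} {a : Fin n → ℕ} (ha : a ∈ staircase n) :
    (∑ i, a i) * 2 ≤ n * (n - 1) := by
  rw [← Finset.sum_range_id_mul_two, ← Fin.sum_univ_eq_sum_range (fun i => i) n]
  exact Nat.mul_le_mul_right _ (Finset.sum_le_sum fun i _ => mem_staircase.1 ha i)

theorem span_pow_adjoin_singleton {R A : Type*} [CommRing R] [CommRing A] [Algebra R A] (y : A)
    (F : R[X]) (hF : F.Monic) (hy : aeval y F = 0) (hdeg : F.natDegree ≠ 0) :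
    Submodule.span R {z : Algebra.adjoin R {y} | ∃ j < F.natDegree, (z : A) = y ^ j} = ⊤ := by
  rw [eq_top_iff]
  rintro ⟨z, hz⟩ -
  obtain ⟨p, rfl⟩ := Algebra.adjoin_singleton_eq_range_aeval R y ▸ hz
  set Y : Algebra.adjoin R {y} := ⟨y, Algebra.self_mem_adjoin_singleton R y⟩
  have key : (⟨aeval y p, hz⟩ : Algebra.adjoin R {y}) =
      ∑ j ∈ Finset.range F.natDegree, (p %ₘ F).coeff j • Y ^ j := by
    apply Subtype.ext
    rw [AddSubmonoidClass.coe_finsetSum]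
    change aeval y p = ∑ j ∈ Finset.range F.natDegree, (p %ₘ F).coeff j • y ^ j
    rw [← aeval_eq_sum_range' (natDegree_modByMonic_lt p hF (by
      rintro rfl; exact hdeg natDegree_one)), ← aeval_modByMonic_eq_self_of_root hy]
  change (⟨aeval y p, hz⟩ : Algebra.adjoin R {y}) ∈ _
  rw [key]
  exact Submodule.sum_mem _ fun j hj => Submodule.smul_mem _ _ <| Submodule.subset_span
    ⟨j, Finset.mem_range.1 hj, rfl⟩

/-- Adjoin the last element y first: it is a root of a monic polynomial of degree n + 1, so its
powers up to n span R[y]. Dividing that polynomial by X - y leaves the product for the other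
elements, now with coefficients in R[y]; this is why R varies in the induction. -/
theorem adjoin_le_span_staircase {A : Type*} [CommRing A] [Nontrivial A] (n : ℕ) (R : Subring A)
    (x : Fin n → A) (h : ∏ i, (X - C (x i)) ∈ lifts (algebraMap R A)) :
    (Algebra.adjoin R (Set.range x) : Set A) ⊆
      Submodule.span R ((fun a : Fin n → ℕ => ∏ i, x i ^ a i) '' staircase n) := by
  induction n generalizing R with
  | zero =>
    intro z hz
    rw [Set.range_eq_empty x, Algebra.adjoin_empty] at hz
    obtain ⟨r, rfl⟩ := Algebra.mem_bot.1 hz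
    rw [Algebra.algebraMap_eq_smul_one]
    exact Submodule.smul_mem _ _ (Submodule.subset_span ⟨0, by simp [mem_staircase]⟩)
  | succ n ih =>
    obtain ⟨F, hFmap, hFdeg, hFmonic⟩ :=
      lifts_and_natDegree_eq_and_monic h (monic_prod_of_monic _ _ fun i _ => monic_X_sub_C _)
    have hdeg : F.natDegree = n + 1 := by
      rw [hFdeg, natDegree_prod_of_monic _ _ fun i _ => monic_X_sub_C _]; simp
    set y := x (Fin.last n)
    have hy : aeval y F = 0 := by
      rw [← eval_map_algebraMap, hFmap, eval_prod]
      exact Finset.prod_eq_zero (Finset.mem_univ (Fin.last n)) (by simp [y])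
    set R' := Algebra.adjoin R {y}
    have hspan := span_pow_adjoin_singleton y F hFmonic hy (by omega)
    have hlift : ∏ i : Fin n, (X - C (x i.castSucc)) ∈ lifts (algebraMap R'.toSubring A) := by
      set Y : R'.toSubring := ⟨y, Algebra.self_mem_adjoin_singleton R y⟩
      set F' : R'.toSubring[X] := F.map (algebraMap R R')
      have hF'map : F'.map (algebraMap R'.toSubring A) = ∏ i, (X - C (x i)) := by
        rw [← hFmap, map_map]; rfl
      have hroot : F'.IsRoot Y := by
        apply (Subtype.val_injective : Function.Injective (algebraMap R'.toSubring A))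
        change algebraMap R'.toSubring A (eval Y F') = algebraMap R'.toSubring A 0
        rw [map_zero, ← eval₂_hom, ← eval_map, hF'map, eval_prod]
        exact Finset.prod_eq_zero (Finset.mem_univ (Fin.last n)) (by
          rw [eval_sub, eval_X, eval_C]; exact sub_self y)
      obtain ⟨q, hq⟩ := dvd_iff_isRoot.2 hroot
      refine (mem_lifts _).2 ⟨q, ?_⟩
      have := congrArg (map (algebraMap R'.toSubring A)) hq
      rw [hF'map, Fin.prod_univ_castSucc, Polynomial.map_mul, mul_comm] at this
      have hX : (X - C Y).map (algebraMap R'.toSubring A) = X - C y := by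
        simp only [Polynomial.map_sub, map_X, map_C]; rfl
      rw [hX] at this
      exact ((monic_X_sub_C y).isRegular.left this).symm
    have key := ih R'.toSubring (fun i => x i.castSucc) hlift
    intro z hz
    have hz' : z ∈ Algebra.adjoin R'.toSubring (Set.range fun i : Fin n => x i.castSucc) := by
      induction hz using Algebra.adjoin_induction with
      | mem z hz =>
        obtain ⟨i, rfl⟩ := hz
        induction i using Fin.lastCases with
        | last =>
          exact Subalgebra.algebraMap_mem _
            (⟨y, Algebra.self_mem_adjoin_singleton R y⟩ : R'.toSubring)
        | cast i => exact Algebra.subset_adjoin ⟨i, rfl⟩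
      | algebraMap r => exact Subalgebra.algebraMap_mem _ (algebraMap R R' r : R'.toSubring)
      | add _ _ _ _ h₁ h₂ => exact add_mem h₁ h₂
      | mul _ _ _ _ h₁ h₂ => exact mul_mem h₁ h₂
    have hz'' : z ∈ (Submodule.span R' ((fun a : Fin n → ℕ => ∏ i, x i.castSucc ^ a i) ''
      staircase n)).restrictScalars R := key hz'
    rw [← Submodule.span_smul_of_span_eq_top hspan] at hz''
    refine Submodule.span_mono ?_ hz''
    rintro _ ⟨c, ⟨j, hj, hc⟩, _, ⟨a, ha, rfl⟩, rfl⟩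
    refine ⟨Fin.snoc a j, mem_staircase.2 fun i => ?_, ?_⟩
    · induction i using Fin.lastCases with
      | last => simp; omega
      | cast i => simpa using mem_staircase.1 ha i
    · simp only [Fin.prod_univ_castSucc, Fin.snoc_castSucc, Fin.snoc_last]
      rw [mul_comm, Subalgebra.smul_def, hc, smul_eq_mul]

end Staircase

/-! ### From power sums to elementary symmetric polynomials -/

section PowerSums

open MvPolynomial

/-- Newton's identity expresses k · e_k through earlier e_j and power sums; characteristic zero
allows division by k. -/
theorem esymm_mem_adjoin_psum {K σ : Type*} [Field K] [CharZero K] [Fintype σ] (k : ℕ)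
    (hk : k ≤ Fintype.card σ) :
    esymm σ K k ∈ Algebra.adjoin K
      (Set.range fun m : Fin (Fintype.card σ) => psum σ K ((m : ℕ) + 1)) := by
  induction k using Nat.strong_induction_on with
  | _ k ih =>
    rcases Nat.eq_zero_or_pos k with rfl | hpos
    · rw [esymm_zero]; exact one_mem _
    have hk0 : (k : K) ≠ 0 := Nat.cast_ne_zero.2 hpos.ne'
    have key : esymm σ K k = (k : K)⁻¹ • ((k : MvPolynomial σ K) * esymm σ K k) := by
      rw [← nsmul_eq_mul, ← Nat.cast_smul_eq_nsmul K, smul_smul, inv_mul_cancel₀ hk0, one_smul]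
    rw [key, mul_esymm_eq_sum]
    refine Subalgebra.smul_mem _ (mul_mem (pow_mem (neg_mem (one_mem _)) _)
      (sum_mem fun a ha => ?_)) _
    obtain ⟨ha1, ha2⟩ := Finset.mem_filter.1 ha
    have hsum : a.1 + a.2 = k := by simpa using ha1
    refine mul_mem (mul_mem (pow_mem (neg_mem (one_mem _)) _) (ih a.1 ha2 (by omega))) ?_
    refine Algebra.subset_adjoin ⟨⟨a.2 - 1, by omega⟩, ?_⟩
    simp only
    congr 1
    omega

theorem prod_X_sub_C_mem_lifts {K σ A : Type*} [Field K] [CharZero K] [Fintype σ] [CommRing A]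
    [Algebra K A] (P : Subalgebra K A) (x : σ → A)
    (hx : ∀ m < Fintype.card σ, ∑ i, x i ^ (m + 1) ∈ P) :
    ∏ i, (Polynomial.X - Polynomial.C (x i)) ∈ Polynomial.lifts (algebraMap P A) := by
  have hP : ∀ k ≤ Fintype.card σ, aeval x (esymm σ K k) ∈ P := fun k hk => by
    have hle : (Algebra.adjoin K
        (Set.range fun m : Fin (Fintype.card σ) => psum σ K ((m : ℕ) + 1))).map (aeval x) ≤ P := by
      rw [AlgHom.map_adjoin, Algebra.adjoin_le_iff]
      rintro _ ⟨_, ⟨m, rfl⟩, rfl⟩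
      simpa [psum] using hx m m.2
    exact hle ⟨_, esymm_mem_adjoin_psum k hk, rfl⟩
  -- Vieta's formula is available for ∏ (X + x_i); substituting -X and multiplying by a sign for
  -- each factor gives ∏ (X - x_i).
  have hprod : ∏ i, (Polynomial.X - Polynomial.C (x i)) =
      ((∏ i : σ, (Polynomial.X + Polynomial.C (X i : MvPolynomial σ K))).map
        (aeval x : MvPolynomial σ K →ₐ[K] A).toRingHom).comp (-Polynomial.X) *
          (-1) ^ Fintype.card σ := by
    rw [Polynomial.map_prod, Polynomial.prod_comp, ← Finset.card_univ, ← Finset.prod_const,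
      ← Finset.prod_mul_distrib]
    refine Finset.prod_congr rfl fun i _ => ?_
    simp [sub_eq_neg_add]
  rw [hprod, prod_C_add_X_eq_sum_esymm, Polynomial.map_sum, Polynomial.sum_comp]
  refine mul_mem (sum_mem fun j hj => ?_) (pow_mem ((Polynomial.mem_lifts _).2 ⟨-1, by simp⟩) _)
  simp only [Polynomial.map_mul, Polynomial.map_C, Polynomial.map_pow, Polynomial.map_X,
    Polynomial.mul_comp, Polynomial.C_comp, Polynomial.pow_comp, Polynomial.X_comp]
  refine mul_mem ?_ (pow_mem ((Polynomial.mem_lifts _).2 ⟨-Polynomial.X, by simp⟩) _)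
  exact Polynomial.C_mem_lifts (algebraMap P A)
    ⟨_, hP j (Nat.lt_succ_iff.1 (Finset.mem_range.1 hj))⟩

end PowerSums

/-! ### Monomials spanning the polynomial ring over the power sums -/

section Generation

open MvPolynomial

/-- The monomial `x^a y^b` attached to a pair of exponents `(a, b)`. -/
noncomputable def pairMonomial (K : Type*) [Field K] (n : ℕ) (p : (Fin n → ℕ) × (Fin n → ℕ)) :
    MvPolynomial (Fin n ⊕ Fin n) K :=
  (∏ i, X (Sum.inl i) ^ p.1 i) * ∏ i, X (Sum.inr i) ^ p.2 i

theorem pairMonomial_isHomogeneous (K : Type*) [Field K] (n : ℕ)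
    (p : (Fin n → ℕ) × (Fin n → ℕ)) :
    (pairMonomial K n p).IsHomogeneous (∑ i, p.1 i + ∑ i, p.2 i) :=
  (IsHomogeneous.prod _ _ _ fun _ _ => isHomogeneous_X_pow _ _).mul
    (IsHomogeneous.prod _ _ _ fun _ _ => isHomogeneous_X_pow _ _)

/-- The subalgebra `K[L_1, …, L_n, R_1, …, R_n]` generated by the unmixed power sums. -/
noncomputable abbrev powerSumAlgebra (K : Type*) [Field K] (n : ℕ) :
    Subalgebra K (MvPolynomial (Fin n ⊕ Fin n) K) :=
  Algebra.adjoin K (Set.range (unmixedPowerSum K n))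

theorem prod_inl_mem_lifts (K : Type*) [Field K] [CharZero K] (n : ℕ) :
    ∏ i : Fin n, (Polynomial.X - Polynomial.C (X (Sum.inl i) : MvPolynomial (Fin n ⊕ Fin n) K)) ∈
      Polynomial.lifts (algebraMap (powerSumAlgebra K n) _) := by
  refine prod_X_sub_C_mem_lifts (powerSumAlgebra K n) _ fun m hm => ?_
  rw [Fintype.card_fin] at hm
  exact Algebra.subset_adjoin ⟨Sum.inl ⟨m, hm⟩, rfl⟩

theorem prod_inr_mem_lifts (K : Type*) [Field K] [CharZero K] (n : ℕ) :
    ∏ i : Fin n, (Polynomial.X - Polynomial.C (X (Sum.inr i) : MvPolynomial (Fin n ⊕ Fin n) K)) ∈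
      Polynomial.lifts (algebraMap (powerSumAlgebra K n) _) := by
  refine prod_X_sub_C_mem_lifts (powerSumAlgebra K n) _ fun m hm => ?_
  rw [Fintype.card_fin] at hm
  exact Algebra.subset_adjoin ⟨Sum.inr ⟨m, hm⟩, rfl⟩

theorem span_pairMonomial (K : Type*) [Field K] [CharZero K] (n : ℕ) :
    Submodule.span (powerSumAlgebra K n)
      (pairMonomial K n '' (staircase n ×ˢ staircase n : Finset _)) = ⊤ := by
  set P := powerSumAlgebra K n
  set A := MvPolynomial (Fin n ⊕ Fin n) K
  let x : Fin n → A := fun i => X (Sum.inl i)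
  let y : Fin n → A := fun i => X (Sum.inr i)
  let R₁ := Algebra.adjoin P.toSubring (Set.range x)
  -- The staircase bound is used twice: for the x_i over P, then for the y_i over P[x].
  have h₁ := adjoin_le_span_staircase n P.toSubring x (prod_inl_mem_lifts K n)
  have h₂ := adjoin_le_span_staircase n R₁.toSubring y (by
    obtain ⟨q, hq⟩ := (Polynomial.mem_lifts _).1 (prod_inr_mem_lifts K n)
    refine (Polynomial.mem_lifts _).2 ⟨q.map (algebraMap P.toSubring R₁), ?_⟩
    rw [Polynomial.map_map, ← hq]
    rfl)
  rw [eq_top_iff]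
  intro z _
  have hz : z ∈ Algebra.adjoin R₁.toSubring (Set.range y) := by
    induction z using MvPolynomial.induction_on with
    | C c =>
      exact Subalgebra.algebraMap_mem _
        (algebraMap P.toSubring R₁ (algebraMap K P c) : R₁.toSubring)
    | add _ _ h₁ h₂ => exact add_mem (h₁ trivial) (h₂ trivial)
    | mul_X p i h =>
      refine mul_mem (h trivial) ?_
      rcases i with i | i
      · exact Subalgebra.algebraMap_mem _ (⟨x i, Algebra.subset_adjoin ⟨i, rfl⟩⟩ : R₁.toSubring)
      · exact Algebra.subset_adjoin ⟨i, rfl⟩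
  obtain ⟨k, f, g, rfl⟩ := Submodule.mem_span_set'.1 (h₂ hz)
  refine Submodule.sum_mem _ fun j _ => ?_
  obtain ⟨b, hb, hg⟩ := (g j).2
  rw [← hg]
  have hf := h₁ (f j).2
  change ((f j : R₁.toSubring) : A) * _ ∈ _
  generalize ((f j : R₁.toSubring) : A) = c at hf ⊢
  change c ∈ Submodule.span P _ at hf
  induction hf using Submodule.span_induction with
  | mem c hc =>
    obtain ⟨a, ha, rfl⟩ := hc
    exact Submodule.subset_span ⟨(a, b), by simpa using ⟨ha, hb⟩, rfl⟩
  | zero => rw [zero_mul]; exact zero_mem _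
  | add _ _ _ _ h₁ h₂ => rw [add_mul]; exact add_mem h₁ h₂
  | smul r _ _ h => rw [smul_mul_assoc]; exact Submodule.smul_mem _ _ h

end Generation

/-! ### Graded Nakayama and reduction modulo the primary invariants -/

section Graded

open MvPolynomial

variable {K τ ι : Type*} [Field K] {θ : ι → MvPolynomial τ K} {m : ι → ℕ}

theorem homogeneousComponent_mul_of_isHomogeneous {f : MvPolynomial τ K} {k : ℕ}
    (hf : f.IsHomogeneous k) (a : MvPolynomial τ K) (d : ℕ) :
    homogeneousComponent d (f * a) = if k ≤ d then f * homogeneousComponent (d - k) a else 0 := by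
  induction a using MvPolynomial.induction_on' with
  | monomial u r =>
    have h := isHomogeneous_monomial (R := K) r (rfl : u.degree = u.degree)
    rw [homogeneousComponent_of_mem (hf.mul h), homogeneousComponent_of_mem h]
    split_ifs <;> first | rfl | omega | simp
  | add p q hp hq =>
    rw [mul_add, map_add, hp, hq, map_add]
    split_ifs <;> ring

theorem sub_C_constantCoeff_mem_span (hθ : ∀ j, (θ j).IsHomogeneous (m j)) (hm : ∀ j, 0 < m j)
    {p : MvPolynomial τ K} (hp : p ∈ Algebra.adjoin K (Set.range θ)) :
    p - C (constantCoeff p) ∈ Ideal.span (Set.range θ) := by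
  induction hp using Algebra.adjoin_induction with
  | mem p hp =>
    obtain ⟨j, rfl⟩ := hp
    have : constantCoeff (θ j) = 0 := (hθ j).coeff_eq_zero (by simpa using (hm j).ne)
    rw [this, C_0, sub_zero]
    exact Ideal.subset_span ⟨j, rfl⟩
  | algebraMap r => simp [MvPolynomial.algebraMap_eq]
  | add p q _ _ hp hq =>
    rw [map_add, map_add, add_sub_add_comm]
    exact add_mem hp hq
  | mul p q _ _ hp hq =>
    rw [map_mul, map_mul, show p * q - C (constantCoeff p) * C (constantCoeff q) =
      p * (q - C (constantCoeff q)) + C (constantCoeff q) * (p - C (constantCoeff p)) by ring]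
    exact add_mem (Ideal.mul_mem_left _ _ hq) (Ideal.mul_mem_left _ _ hp)

theorem homogeneousComponent_mem_span_range (hθ : ∀ j, (θ j).IsHomogeneous (m j))
    {a : MvPolynomial τ K} (ha : a ∈ Ideal.span (Set.range θ)) (d : ℕ) :
    homogeneousComponent d a ∈ Ideal.span (Set.range θ) := by
  let _ : GradedAlgebra (homogeneousSubmodule τ K) := MvPolynomial.gradedAlgebra
  refine homogeneousComponent_mem_of_mem (Ideal.homogeneous_span _ _ ?_) ha d
  rintro _ ⟨j, rfl⟩
  exact ⟨m j, hθ j⟩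

/-- Modulo the ideal, each coefficient in P can be replaced by its constant term. -/
theorem exists_mem_span_sub_mem (hθ : ∀ j, (θ j).IsHomogeneous (m j)) (hm : ∀ j, 0 < m j)
    (P : Subalgebra K (MvPolynomial τ K)) (hP : P = Algebra.adjoin K (Set.range θ))
    {T : Set (MvPolynomial τ K)} {z : MvPolynomial τ K} (hz : z ∈ Submodule.span P T) :
    ∃ b ∈ Submodule.span K T, z - b ∈ Ideal.span (Set.range θ) := by
  induction hz using Submodule.span_induction with
  | mem z hz => exact ⟨z, Submodule.subset_span hz, by simp⟩
  | zero => exact ⟨0, zero_mem _, by simp⟩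
  | add y z _ _ hy hz =>
    obtain ⟨b, hb, hyb⟩ := hy
    obtain ⟨c, hc, hzc⟩ := hz
    exact ⟨b + c, add_mem hb hc, by rw [add_sub_add_comm]; exact add_mem hyb hzc⟩
  | smul p z _ hz =>
    obtain ⟨b, hb, hzb⟩ := hz
    refine ⟨constantCoeff (p : MvPolynomial τ K) • b, Submodule.smul_mem _ _ hb, ?_⟩
    rw [Subalgebra.smul_def, smul_eq_mul, smul_eq_C_mul,
      show (p : MvPolynomial τ K) * z - C (constantCoeff (p : MvPolynomial τ K)) * b =
        z * ((p : MvPolynomial τ K) - C (constantCoeff (p : MvPolynomial τ K))) +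
          C (constantCoeff (p : MvPolynomial τ K)) * (z - b) by ring]
    exact add_mem (Ideal.mul_mem_left _ _ (sub_C_constantCoeff_mem_span hθ hm (hP ▸ p.2)))
      (Ideal.mul_mem_left _ _ hzb)

/-- Modulo the ideal z is a K-combination of T, whose component of degree d vanishes; the ideal is
homogeneous. Both degree bounds rest on this. -/
theorem mem_span_range_of_forall_degree_ne (hθ : ∀ j, (θ j).IsHomogeneous (m j))
    (hm : ∀ j, 0 < m j) (P : Subalgebra K (MvPolynomial τ K))
    (hP : P = Algebra.adjoin K (Set.range θ)) {T : Set (MvPolynomial τ K)} {d : ℕ}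
    (hT : ∀ t ∈ T, ∃ e ≠ d, t.IsHomogeneous e) {z : MvPolynomial τ K}
    (hz : z ∈ Submodule.span P T) (hzd : z.IsHomogeneous d) :
    z ∈ Ideal.span (Set.range θ) := by
  obtain ⟨b, hb, hzb⟩ := exists_mem_span_sub_mem hθ hm P hP hz
  have hb0 : homogeneousComponent d b = 0 := by
    clear hzb
    induction hb using Submodule.span_induction with
    | mem b hb =>
      obtain ⟨e, hed, he⟩ := hT b hb
      rw [homogeneousComponent_of_mem he, if_neg hed.symm]
    | zero => rw [map_zero]
    | add _ _ _ _ h₁ h₂ => rw [map_add, h₁, h₂, add_zero]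
    | smul c _ _ h => rw [map_smul, h, smul_zero]
  have := homogeneousComponent_mem_span_range hθ hzb d
  rwa [map_sub, hb0, sub_zero, homogeneousComponent_of_mem hzd, if_pos rfl] at this

/-- A graded form of Nakayama's lemma. -/
theorem span_adjoin_eq_top [Fintype ι] (hθ : ∀ j, (θ j).IsHomogeneous (m j)) (hm : ∀ j, 0 < m j)
    (B : Set (MvPolynomial τ K)) (hB : ∀ b ∈ B, ∃ d, b.IsHomogeneous d)
    (h : ∀ a, ∃ b ∈ Submodule.span K B, a - b ∈ Ideal.span (Set.range θ)) :
    Submodule.span (Algebra.adjoin K (Set.range θ)) B = ⊤ := by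
  set P := Algebra.adjoin K (Set.range θ)
  have hKP : ∀ b ∈ Submodule.span K B, ∀ d, homogeneousComponent d b ∈ Submodule.span P B := by
    intro b hb d
    induction hb using Submodule.span_induction with
    | mem b hb =>
      obtain ⟨e, he⟩ := hB b hb
      rw [homogeneousComponent_of_mem he]
      split_ifs
      exacts [Submodule.subset_span hb, zero_mem _]
    | zero => rw [map_zero]; exact zero_mem _
    | add _ _ _ _ h₁ h₂ => rw [map_add]; exact add_mem h₁ h₂
    | smul c _ _ h =>
      rw [map_smul, ← algebraMap_smul P c]
      exact Submodule.smul_mem _ _ h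
  have hom : ∀ d a, homogeneousComponent d a ∈ Submodule.span P B := by
    intro d
    induction d using Nat.strong_induction_on with
    | _ d ih =>
      intro a
      obtain ⟨b, hb, hab⟩ := h a
      obtain ⟨c, hc⟩ := Ideal.mem_span_range_iff_exists_fun.1 hab
      rw [← sub_add_cancel a b, ← hc, map_add, map_sum]
      refine add_mem (Submodule.sum_mem _ fun j _ => ?_) (hKP b hb d)
      -- As θ_j has positive degree, only components of c_j of degree below d occur, and induction
      -- applies.
      rw [mul_comm, homogeneousComponent_mul_of_isHomogeneous (hθ j)]
      split_ifs with hle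
      · exact Submodule.smul_mem _ (⟨θ j, Algebra.subset_adjoin ⟨j, rfl⟩⟩ : P)
          (ih _ (by have := hm j; omega) _)
      · exact zero_mem _
  rw [eq_top_iff]
  intro a _
  rw [← sum_homogeneousComponent a]
  exact Submodule.sum_mem _ fun d _ => hom d a

theorem exists_homogeneous_basis_range [Fintype ι] (hθ : ∀ j, (θ j).IsHomogeneous (m j))
    (hm : ∀ j, 0 < m j)
    (P : Subalgebra K (MvPolynomial τ K)) (hP : P = Algebra.adjoin K (Set.range θ))
    (π : MvPolynomial τ K →ₗ[P] MvPolynomial τ K)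
    (hπ : ∀ a, π (π a) = π a) (hπd : ∀ a d, a.IsHomogeneous d → (π a).IsHomogeneous d)
    {κ : Type*} [Fintype κ] (t : κ → MvPolynomial τ K) (ht : ∀ k, ∃ d, (t k).IsHomogeneous d)
    (hspan : Submodule.span P (Set.range t) = ⊤)
    (hcard : Fintype.card κ ≤ Module.finrank P (MvPolynomial τ K)) :
    ∃ S : Set (MvPolynomial τ K), (∀ g ∈ S, ∃ d, g.IsHomogeneous d) ∧
      LinearIndepOn P id S ∧
      Submodule.span P S = LinearMap.range π := by
  set I := Ideal.span (Set.range θ)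
  let q : MvPolynomial τ K →ₗ[K] MvPolynomial τ K ⧸ I := (Ideal.Quotient.mkₐ K I).toLinearMap
  have hq : ∀ a b, q a = q b ↔ a - b ∈ I := fun a b => Ideal.Quotient.eq
  have hqsurj : Function.Surjective q := Ideal.Quotient.mk_surjective
  have hqt : Submodule.span K (Set.range (q ∘ t)) = ⊤ := by
    rw [eq_top_iff]
    intro z _
    obtain ⟨a, rfl⟩ := hqsurj z
    obtain ⟨b, hb, hab⟩ := exists_mem_span_sub_mem hθ hm P hP
      (hspan ▸ Submodule.mem_top : a ∈ Submodule.span P (Set.range t))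
    rw [(hq a b).2 hab, Set.range_comp, ← Submodule.map_span]
    exact ⟨b, hb, rfl⟩
  have hfin : Module.Finite K (MvPolynomial τ K ⧸ I) :=
    ⟨hqt ▸ Submodule.fg_span (Set.finite_range _)⟩
  have hfinrank : Module.finrank K (MvPolynomial τ K ⧸ I) ≤ Fintype.card κ := by
    have := finrank_range_le_card (R := K) (q ∘ t)
    rwa [Set.finrank, hqt, finrank_top] at this
  -- Splitting each generator along π makes every candidate either fixed or killed by π.
  let w : κ ⊕ κ → MvPolynomial τ K := Sum.elim (fun k => π (t k)) fun k => t k - π (t k)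
  have hw : ∀ k, ∃ d, (w k).IsHomogeneous d := by
    rintro (k | k) <;> obtain ⟨d, hd⟩ := ht k
    exacts [⟨d, hπd _ _ hd⟩, ⟨d, hd.sub (hπd _ _ hd)⟩]
  obtain ⟨κ', a, ha, hspan', hli⟩ := exists_linearIndependent' K (q ∘ w)
  have : Finite κ' := Finite.of_injective a ha
  have := Fintype.ofFinite κ'
  have htop : Submodule.span K (Set.range ((q ∘ w) ∘ a)) = ⊤ := by
    rw [hspan', eq_top_iff, ← hqt, Submodule.span_le]
    rintro _ ⟨k, rfl⟩
    have : (q ∘ t) k = (q ∘ w) (Sum.inl k) + (q ∘ w) (Sum.inr k) := by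
      simp [w]
    rw [this]
    exact add_mem (Submodule.subset_span ⟨_, rfl⟩) (Submodule.subset_span ⟨_, rfl⟩)
  have hB : Submodule.span P (Set.range (w ∘ a)) = ⊤ := by
    subst hP
    refine span_adjoin_eq_top hθ hm _ ?_ fun z => ?_
    · rintro _ ⟨k, rfl⟩
      exact hw _
    · have hz : q z ∈ (Submodule.span K (Set.range (w ∘ a))).map q := by
        rw [Submodule.map_span, ← Set.range_comp]
        exact htop ▸ Submodule.mem_top
      obtain ⟨b, hb, hbz⟩ := hz
      exact ⟨b, hb, (hq _ _).1 hbz.symm⟩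
  -- A spanning family with no more members than the rank is independent.
  have hBli : LinearIndependent P (w ∘ a) :=
    linearIndependent_of_top_le_span_of_card_le_finrank hB.ge
      ((hli.fintype_card_le_finrank.trans hfinrank).trans hcard)
  refine ⟨(w ∘ a) '' {k | (a k).isLeft}, ?_, hBli.linearIndepOn_id.mono (Set.image_subset_range _ _),
    le_antisymm ?_ ?_⟩
  · rintro _ ⟨k, -, rfl⟩
    exact hw _
  · rw [Submodule.span_le]
    rintro _ ⟨k, hk, rfl⟩
    obtain ⟨j, hj⟩ := Sum.isLeft_iff.1 hk
    exact ⟨t j, by simp [hj, w]⟩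
  · rintro _ ⟨z, rfl⟩
    have hz : z ∈ Submodule.span P (Set.range (w ∘ a)) := hB ▸ Submodule.mem_top
    induction hz using Submodule.span_induction with
    | mem z hz =>
      obtain ⟨k, rfl⟩ := hz
      rcases hk : a k with j | j
      · have : π ((w ∘ a) k) = (w ∘ a) k := by simp [hk, w, hπ]
        rw [this]
        exact Submodule.subset_span ⟨k, by simp [hk], rfl⟩
      · have : π ((w ∘ a) k) = 0 := by simp [hk, w, hπ]
        rw [this]
        exact zero_mem _
    | zero => rw [map_zero]; exact zero_mem _
    | add _ _ _ _ h₁ h₂ => rw [map_add]; exact add_mem h₁ h₂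
    | smul c _ _ h => rw [map_smul]; exact Submodule.smul_mem _ _ h

/-- Comparing coefficients at g would give 1 as a combination of the p_j, whose constant term is 0.
-/
theorem sum_smul_ne_of_linearIndepOn [Fintype ι] (P : Subalgebra K (MvPolynomial τ K))
    {S : Set (MvPolynomial τ K)} (hS : LinearIndepOn P id S) (p : ι → P)
    (hp : ∀ j, constantCoeff (p j : MvPolynomial τ K) = 0) (a : ι → MvPolynomial τ K)
    (ha : ∀ j, a j ∈ Submodule.span P S) {g : MvPolynomial τ K} (hg : g ∈ S) :
    ∑ j, p j • a j ≠ g := by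
  intro h
  have hl : ∀ j, ∃ l : S →₀ P, Finsupp.linearCombination P (fun x : S => id (x : MvPolynomial τ K)) l
      = a j := fun j => (Finsupp.mem_span_iff_linearCombination P S (a j)).1 (ha j)
  choose l hl using hl
  have key : ∑ j, p j • l j = Finsupp.single (⟨g, hg⟩ : S) 1 := by
    apply hS
    rw [map_sum, Finsupp.linearCombination_single, one_smul]
    simp only [map_smul, hl]
    exact h
  have hone := DFunLike.congr_fun key ⟨g, hg⟩
  rw [Finsupp.single_eq_same, Finsupp.finsetSum_apply] at hone
  have := congrArg (fun q : P => constantCoeff (q : MvPolynomial τ K)) hone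
  simp [hp] at this

end Graded

/-! ### An invariant of degree n(n-1) outside the ideal -/

section Alternation

open MvPolynomial Equiv.Perm

variable (K : Type*) [Field K] (n : ℕ)

theorem rename_unmixedPowerSum (p : Equiv.Perm (Fin n) × Equiv.Perm (Fin n)) (j : Fin n ⊕ Fin n) :
    rename (sumCongrHom _ _ p) (unmixedPowerSum K n j) = unmixedPowerSum K n j := by
  rcases j with m | m
  · simp only [unmixedPowerSum, map_sum, map_pow, rename_X]
    exact Equiv.sum_comp p.1 fun i => (X (Sum.inl i) : MvPolynomial (Fin n ⊕ Fin n) K) ^ (_ + 1)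
  · simp only [unmixedPowerSum, map_sum, map_pow, rename_X]
    exact Equiv.sum_comp p.2 fun i => (X (Sum.inr i) : MvPolynomial (Fin n ⊕ Fin n) K) ^ (_ + 1)

theorem unmixedPowerSum_isHomogeneous (j : Fin n ⊕ Fin n) :
    (unmixedPowerSum K n j).IsHomogeneous (Sum.elim (fun m : Fin n => (m : ℕ) + 1)
      (fun m : Fin n => (m : ℕ) + 1) j) := by
  rcases j with m | m <;>
  exact IsHomogeneous.sum _ _ _ fun _ _ => isHomogeneous_X_pow _ _

/-- The product of the two sign characters of `S_n × S_n`, with values in `K`. -/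
def signProd (p : Equiv.Perm (Fin n) × Equiv.Perm (Fin n)) : K :=
  ((sign p.1 * sign p.2 : ℤˣ) : ℤ)

variable {n} in
theorem signProd_mul (p q : Equiv.Perm (Fin n) × Equiv.Perm (Fin n)) :
    signProd K n (p * q) = signProd K n p * signProd K n q := by
  simp only [signProd, Prod.fst_mul, Prod.snd_mul, map_mul, Units.val_mul, Int.cast_mul]
  ring

variable {n} in
theorem signProd_diag (σ : Equiv.Perm (Fin n)) : signProd K n (σ, σ) = 1 := by
  simp [signProd]

variable {n} in
theorem signProd_inv (p : Equiv.Perm (Fin n) × Equiv.Perm (Fin n)) :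
    signProd K n p⁻¹ = signProd K n p := by
  simp [signProd]

/-- Antisymmetrization with respect to `S_n × S_n`. -/
noncomputable def alternation (f : MvPolynomial (Fin n ⊕ Fin n) K) :
    MvPolynomial (Fin n ⊕ Fin n) K :=
  ∑ p : Equiv.Perm (Fin n) × Equiv.Perm (Fin n), C (signProd K n p) * rename (sumCongrHom _ _ p) f

theorem alternation_mul (j : Fin n ⊕ Fin n) (f : MvPolynomial (Fin n ⊕ Fin n) K) :
    alternation K n (unmixedPowerSum K n j * f) = unmixedPowerSum K n j * alternation K n f := by
  rw [alternation, alternation, Finset.mul_sum]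
  refine Finset.sum_congr rfl fun p _ => ?_
  rw [map_mul, rename_unmixedPowerSum]
  ring

theorem alternation_sum {ι : Type*} (s : Finset ι) (f : ι → MvPolynomial (Fin n ⊕ Fin n) K) :
    alternation K n (∑ i ∈ s, f i) = ∑ i ∈ s, alternation K n (f i) := by
  simp only [alternation, map_sum, Finset.mul_sum]
  exact Finset.sum_comm

theorem rename_alternation (r : Equiv.Perm (Fin n) × Equiv.Perm (Fin n))
    (f : MvPolynomial (Fin n ⊕ Fin n) K) :
    rename (sumCongrHom _ _ r) (alternation K n f) = C (signProd K n r) * alternation K n f := by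
  rw [alternation, map_sum, Finset.mul_sum, ← Equiv.sum_comp (Equiv.mulLeft r⁻¹)]
  refine Finset.sum_congr rfl fun p _ => ?_
  rw [map_mul, rename_C, rename_rename, Equiv.coe_mulLeft, signProd_mul, signProd_inv, C_mul,
    mul_assoc, ← Equiv.Perm.coe_mul, ← map_mul, mul_inv_cancel_left]

/-- Applying r fixes the exponent e but negates the alternation, so the coefficient equals its own
negative. -/
theorem coeff_alternation_eq_zero [CharZero K] (f : MvPolynomial (Fin n ⊕ Fin n) K)
    (e : Fin n ⊕ Fin n →₀ ℕ) (r : Equiv.Perm (Fin n) × Equiv.Perm (Fin n))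
    (hr : signProd K n r = -1) (he : ∀ x, e (sumCongrHom _ _ r x) = e x) :
    coeff e (alternation K n f) = 0 := by
  have hmap : Finsupp.mapDomain (sumCongrHom _ _ r) e = e := by
    ext x
    rw [Finsupp.mapDomain_equiv_apply, ← he, Equiv.apply_symm_apply]
  have := coeff_rename_mapDomain (sumCongrHom _ _ r) (sumCongrHom _ _ r).injective
    (alternation K n f) e
  rw [hmap, rename_alternation, coeff_C_mul, hr] at this
  exact self_eq_neg.1 (by linear_combination -this)

theorem coeff_alternation_eq_zero_of_inl [CharZero K] (f : MvPolynomial (Fin n ⊕ Fin n) K)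
    (e : Fin n ⊕ Fin n →₀ ℕ) {i j : Fin n} (hij : i ≠ j) (he : e (Sum.inl i) = e (Sum.inl j)) :
    coeff e (alternation K n f) = 0 := by
  refine coeff_alternation_eq_zero K n f e (Equiv.swap i j, 1) (by simp [signProd, hij]) ?_
  rintro (k | k)
  · simp only [sumCongrHom_apply, sumCongr_apply, Sum.map_inl, Equiv.swap_apply_def]
    split_ifs <;> simp_all
  · rfl

theorem coeff_alternation_eq_zero_of_inr [CharZero K] (f : MvPolynomial (Fin n ⊕ Fin n) K)
    (e : Fin n ⊕ Fin n →₀ ℕ) {i j : Fin n} (hij : i ≠ j) (he : e (Sum.inr i) = e (Sum.inr j)) :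
    coeff e (alternation K n f) = 0 := by
  refine coeff_alternation_eq_zero K n f e (1, Equiv.swap i j) (by simp [signProd, hij]) ?_
  rintro (k | k)
  · rfl
  · simp only [sumCongrHom_apply, sumCongr_apply, Sum.map_inr, Equiv.swap_apply_def]
    split_ifs <;> simp_all

/-- The exponent of `∏ x_i^i y_i^i`. -/
noncomputable def doubleStaircase : Fin n ⊕ Fin n →₀ ℕ :=
  Finsupp.equivFunOnFinite.symm (Sum.elim (fun i => (i : ℕ)) fun i => (i : ℕ))

theorem degree_doubleStaircase : (doubleStaircase n).degree = n * (n - 1) := by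
  rw [Finsupp.degree_eq_sum, Fintype.sum_sum_type]
  simp only [doubleStaircase, Finsupp.equivFunOnFinite_symm_apply_apply, Sum.elim_inl, Sum.elim_inr]
  rw [← mul_two, Fin.sum_univ_eq_sum_range (fun i => i) n, Finset.sum_range_id_mul_two]

theorem coeff_doubleStaircase_mul_alternation [CharZero K] (j : Fin n ⊕ Fin n)
    (f : MvPolynomial (Fin n ⊕ Fin n) K) :
    coeff (doubleStaircase n) (unmixedPowerSum K n j * alternation K n f) = 0 := by
  rcases j with m | m
  · rw [unmixedPowerSum, Finset.sum_mul, coeff_sum]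
    refine Finset.sum_eq_zero fun i _ => ?_
    rw [X_pow_eq_monomial, coeff_monomial_mul']
    split_ifs with hle
    · have hi : (m : ℕ) + 1 ≤ i := by simpa [doubleStaircase] using hle (Sum.inl i)
      rw [coeff_alternation_eq_zero_of_inl K n f _
        (i := i) (j := ⟨i - (m + 1), by omega⟩) (by rw [Ne, Fin.ext_iff]; simp only; omega), mul_zero]
      have : i ≠ ⟨i - (m + 1), by omega⟩ := by rw [Ne, Fin.ext_iff]; simp only; omega
      simp [doubleStaircase, this]
    · rfl
  · rw [unmixedPowerSum, Finset.sum_mul, coeff_sum]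
    refine Finset.sum_eq_zero fun i _ => ?_
    rw [X_pow_eq_monomial, coeff_monomial_mul']
    split_ifs with hle
    · have hi : (m : ℕ) + 1 ≤ i := by simpa [doubleStaircase] using hle (Sum.inr i)
      rw [coeff_alternation_eq_zero_of_inr K n f _
        (i := i) (j := ⟨i - (m + 1), by omega⟩) (by rw [Ne, Fin.ext_iff]; simp only; omega), mul_zero]
      have : i ≠ ⟨i - (m + 1), by omega⟩ := by rw [Ne, Fin.ext_iff]; simp only; omega
      simp [doubleStaircase, this]
    · rfl

theorem coeff_doubleStaircase_rename (p : Equiv.Perm (Fin n) × Equiv.Perm (Fin n)) :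
    coeff (doubleStaircase n) (rename (sumCongrHom _ _ p) (monomial (doubleStaircase n) (1 : K))) =
      if p = 1 then 1 else 0 := by
  rw [rename_monomial, coeff_monomial]
  refine if_congr ⟨fun h => ?_, fun h => ?_⟩ rfl rfl
  · have key : ∀ x, doubleStaircase n x = doubleStaircase n (sumCongrHom _ _ p x) := fun x => by
      conv_rhs => rw [← h]
      rw [Finsupp.mapDomain_apply (sumCongrHom _ _ p).injective]
    ext i
    · simpa [doubleStaircase] using (key (Sum.inl i)).symm
    · simpa [doubleStaircase] using (key (Sum.inr i)).symm
  · rw [h, map_one]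
    exact Finsupp.mapDomain_id

/-- The orbit sum of `∏ x_i^i y_i^i` under the diagonal action of `S_n`. -/
noncomputable def staircaseOrbitSum : MvPolynomial (Fin n ⊕ Fin n) K :=
  ∑ ρ : Equiv.Perm (Fin n),
    rename (sumCongrHom _ _ (ρ, ρ)) (monomial (doubleStaircase n) (1 : K))

theorem staircaseOrbitSum_mem : staircaseOrbitSum K n ∈ diagonalInvariants K n := by
  intro σ
  rw [staircaseOrbitSum, map_sum, ← Equiv.sum_comp (Equiv.mulLeft σ) fun ρ =>
    rename (sumCongrHom _ _ (ρ, ρ)) (monomial (doubleStaircase n) (1 : K))]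
  refine Finset.sum_congr rfl fun ρ _ => ?_
  rw [rename_rename]
  congr 2
  ext x
  rcases x with x | x <;> rfl

theorem staircaseOrbitSum_isHomogeneous :
    (staircaseOrbitSum K n).IsHomogeneous (n * (n - 1)) :=
  IsHomogeneous.sum _ _ _ fun _ _ =>
    (isHomogeneous_monomial _ (degree_doubleStaircase n)).rename_isHomogeneous

/-- The staircase exponents are distinct within each block, so each translate by (ρ, ρ) contributes
only through its inverse. The product of signs is 1 on the diagonal, so nothing cancels. -/
theorem coeff_alternation_staircaseOrbitSum :
    coeff (doubleStaircase n) (alternation K n (staircaseOrbitSum K n)) = n.factorial := by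
  rw [staircaseOrbitSum, alternation_sum, coeff_sum]
  have (ρ : Equiv.Perm (Fin n)) : coeff (doubleStaircase n) (alternation K n
      (rename (sumCongrHom _ _ (ρ, ρ)) (monomial (doubleStaircase n) (1 : K)))) = 1 := by
    rw [alternation, coeff_sum, Finset.sum_eq_single (ρ, ρ)⁻¹]
    · rw [coeff_C_mul, signProd_inv, signProd_diag, rename_rename, ← Equiv.Perm.coe_mul, ← map_mul,
        coeff_doubleStaircase_rename]
      simp
    · intro p _ hp
      rw [coeff_C_mul, rename_rename, ← Equiv.Perm.coe_mul, ← map_mul,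
        coeff_doubleStaircase_rename, if_neg, mul_zero]
      exact fun h => hp (eq_inv_of_mul_eq_one_left h)
    · simp
  rw [Finset.sum_congr rfl fun ρ _ => this ρ]
  simp [Fintype.card_perm]

theorem staircaseOrbitSum_notMem_span [CharZero K] :
    staircaseOrbitSum K n ∉ Ideal.span (Set.range (unmixedPowerSum K n)) := by
  intro h
  obtain ⟨c, hc⟩ := Ideal.mem_span_range_iff_exists_fun.1 h
  have key := coeff_alternation_staircaseOrbitSum K n
  rw [← hc, alternation_sum, coeff_sum, Finset.sum_eq_zero] at key
  · exact Nat.factorial_ne_zero n (by exact_mod_cast key.symm)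
  · intro j _
    rw [mul_comm, alternation_mul, coeff_doubleStaircase_mul_alternation]

end Alternation

/-! ### Rank computations and the Reynolds operator -/

section Reynolds

open MvPolynomial Module

variable (K : Type*) [Field K] (n : ℕ)

theorem rename_eq_of_mem_powerSumAlgebra (p : Equiv.Perm (Fin n) × Equiv.Perm (Fin n))
    {f : MvPolynomial (Fin n ⊕ Fin n) K} (hf : f ∈ powerSumAlgebra K n) :
    rename (Equiv.Perm.sumCongrHom _ _ p) f = f := by
  have : powerSumAlgebra K n ≤
      AlgHom.equalizer (rename (Equiv.Perm.sumCongrHom _ _ p)) (AlgHom.id K _) := by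
    rw [Algebra.adjoin_le_iff]
    rintro _ ⟨j, rfl⟩
    exact rename_unmixedPowerSum K n p j
  exact this hf

theorem powerSumAlgebra_le_diagonalInvariants : powerSumAlgebra K n ≤ diagonalInvariants K n :=
  fun _ hf σ => rename_eq_of_mem_powerSumAlgebra K n (σ, σ) hf

theorem span_range_pairMonomial [CharZero K] :
    Submodule.span (powerSumAlgebra K n) (Set.range fun p : (staircase n ×ˢ staircase n : Finset _) =>
      pairMonomial K n p) = ⊤ := by
  rw [← span_pairMonomial, Set.image_eq_range]
  rfl

theorem finrank_powerSumAlgebra [CharZero K] :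
    Module.Finite (powerSumAlgebra K n) (MvPolynomial (Fin n ⊕ Fin n) K) ∧
    finrank (powerSumAlgebra K n) (MvPolynomial (Fin n ⊕ Fin n) K) =
      n.factorial * n.factorial := by
  have hfin : Module.Finite (powerSumAlgebra K n) (MvPolynomial (Fin n ⊕ Fin n) K) :=
    ⟨span_range_pairMonomial K n ▸ Submodule.fg_span (Set.finite_range _)⟩
  refine ⟨hfin, le_antisymm ?_ ?_⟩
  · have := finrank_range_le_card (R := powerSumAlgebra K n)
      fun p : (staircase n ×ˢ staircase n : Finset _) => pairMonomial K n p
    rwa [Set.finrank, span_range_pairMonomial, finrank_top, Fintype.card_coe, Finset.card_product,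
      card_staircase] at this
  -- M is the fixed ring of S_n × S_n; its index (n!)^2 divides the positive rank over P.
  · let M : Subalgebra K (MvPolynomial (Fin n ⊕ Fin n) K) :=
      ⨅ p, AlgHom.equalizer (rename (Equiv.Perm.sumCongrHom _ _ p)) (AlgHom.id K _)
    have hM : ∀ f, f ∈ M ↔ ∀ p, rename (Equiv.Perm.sumCongrHom (Fin n) (Fin n) p) f = f := by
      intro f
      rw [Algebra.mem_iInf]
      rfl
    have hle : powerSumAlgebra K n ≤ M := fun f hf => (hM f).2 fun p =>
      rename_eq_of_mem_powerSumAlgebra K n p hf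
    let N : Submodule (powerSumAlgebra K n) (MvPolynomial (Fin n ⊕ Fin n) K) :=
      { M.toSubmodule.toAddSubmonoid with
        smul_mem' := fun c _ hx => M.mul_mem (hle c.2) hx }
    have h := finrank_mul_finrank_of_coe_eq (powerSumAlgebra K n) M hle N rfl
    rw [finrank_fixed_eq_card _ Equiv.Perm.sumCongrHom_injective M hM, Nat.card_prod, Nat.card_perm,
      Nat.card_eq_fintype_card, Fintype.card_fin] at h
    exact Nat.le_of_dvd finrank_pos ⟨_, by rw [← h, mul_comm]⟩

theorem finrank_diagonalInvariants :
    finrank (diagonalInvariants K n) (MvPolynomial (Fin n ⊕ Fin n) K) = n.factorial := by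
  rw [finrank_fixed_eq_card ((Equiv.Perm.sumCongrHom (Fin n) (Fin n)).comp
    ((MonoidHom.id _).prod (MonoidHom.id _))) ?_ (diagonalInvariants K n) fun f => Iff.rfl,
    Nat.card_perm, Nat.card_eq_fintype_card, Fintype.card_fin]
  exact Equiv.Perm.sumCongrHom_injective.comp fun _ _ h => congrArg Prod.fst h

/-- The Reynolds operator of the diagonal action of `S_n`. -/
noncomputable def reynolds :
    MvPolynomial (Fin n ⊕ Fin n) K →ₗ[powerSumAlgebra K n] MvPolynomial (Fin n ⊕ Fin n) K where
  toFun f := C (n.factorial : K)⁻¹ * ∑ σ : Equiv.Perm (Fin n), rename (Sum.map σ σ) f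
  map_add' f g := by simp only [map_add, Finset.sum_add_distrib, mul_add]
  map_smul' p f := by
    have : ∀ σ : Equiv.Perm (Fin n), rename (Sum.map σ σ) (p : MvPolynomial (Fin n ⊕ Fin n) K) = p :=
      powerSumAlgebra_le_diagonalInvariants K n p.2
    simp only [Subalgebra.smul_def, smul_eq_mul, map_mul, this, ← Finset.mul_sum, RingHom.id_apply]
    ring

theorem reynolds_apply (f : MvPolynomial (Fin n ⊕ Fin n) K) :
    reynolds K n f =
      C (n.factorial : K)⁻¹ * ∑ σ : Equiv.Perm (Fin n), rename (Sum.map σ σ) f := rfl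

theorem reynolds_mem (f : MvPolynomial (Fin n ⊕ Fin n) K) :
    reynolds K n f ∈ diagonalInvariants K n := by
  intro τ
  rw [reynolds_apply, map_mul, rename_C, map_sum, ← Equiv.sum_comp (Equiv.mulLeft τ) fun σ =>
    rename (Sum.map σ σ) f]
  congr 1
  refine Finset.sum_congr rfl fun σ _ => ?_
  rw [rename_rename, Sum.map_comp_map]
  rfl

theorem reynolds_eq_self [CharZero K] {f : MvPolynomial (Fin n ⊕ Fin n) K}
    (hf : f ∈ diagonalInvariants K n) : reynolds K n f = f := by
  rw [reynolds_apply, Finset.sum_congr rfl fun σ _ => hf σ, Finset.sum_const, Finset.card_univ,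
    Fintype.card_perm, Fintype.card_fin, nsmul_eq_mul, ← mul_assoc, ← map_natCast C, ← C_mul,
    inv_mul_cancel₀ (Nat.cast_ne_zero.2 n.factorial_ne_zero), C_1, one_mul]

theorem reynolds_isHomogeneous {f : MvPolynomial (Fin n ⊕ Fin n) K} {d : ℕ}
    (hf : f.IsHomogeneous d) : (reynolds K n f).IsHomogeneous d :=
  (IsHomogeneous.sum _ _ _ fun _ _ => hf.rename_isHomogeneous).C_mul _

theorem range_reynolds [CharZero K] :
    (LinearMap.range (reynolds K n) : Set (MvPolynomial (Fin n ⊕ Fin n) K)) =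
      diagonalInvariants K n := by
  ext f
  exact ⟨fun ⟨g, hg⟩ => hg ▸ reynolds_mem K n g, fun hf => ⟨f, reynolds_eq_self K n hf⟩⟩

end Reynolds

/-! ### Existence, number and top degree of secondary invariants -/

section Secondary

open MvPolynomial Module

variable (K : Type*) [Field K] [CharZero K] (n : ℕ)

theorem algebraicIndependent_unmixedPowerSum : AlgebraicIndependent K (unmixedPowerSum K n) := by
  have := (finrank_powerSumAlgebra K n).1
  have : Algebra.IsAlgebraic (powerSumAlgebra K n) (MvPolynomial (Fin n ⊕ Fin n) K) :=
    Algebra.IsAlgebraic.of_finite _ _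
  exact (Algebra.IsAlgebraic.isTranscendenceBasis_of_lift_le_trdeg_of_finite K
    (unmixedPowerSum K n) (by simp [MvPolynomial.trdeg_of_isDomain])).1

theorem unmixedPowerSum_degree_pos (j : Fin n ⊕ Fin n) :
    0 < Sum.elim (fun m : Fin n => (m : ℕ) + 1) (fun m : Fin n => (m : ℕ) + 1) j := by
  rcases j with m | m <;> exact Nat.succ_pos _

theorem exists_isHironakaDecomposition : ∃ S : Set (MvPolynomial (Fin n ⊕ Fin n) K),
    IsHironakaDecomposition (diagonalInvariants K n) (unmixedPowerSum K n) S := by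
  obtain ⟨S, hS, hli, hspan⟩ := exists_homogeneous_basis_range (unmixedPowerSum_isHomogeneous K n)
    (unmixedPowerSum_degree_pos n) (powerSumAlgebra K n) rfl (reynolds K n)
    (fun a => reynolds_eq_self K n (reynolds_mem K n a)) (fun _ _ => reynolds_isHomogeneous K n)
    (fun p : (staircase n ×ˢ staircase n : Finset _) => pairMonomial K n p)
    (fun p => ⟨_, pairMonomial_isHomogeneous K n p⟩) (span_range_pairMonomial K n)
    (by rw [(finrank_powerSumAlgebra K n).2, Fintype.card_coe, Finset.card_product, card_staircase])
  exact ⟨S, fun j => powerSumAlgebra_le_diagonalInvariants K n (Algebra.subset_adjoin ⟨j, rfl⟩),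
    fun j => ⟨_, unmixedPowerSum_isHomogeneous K n j⟩, algebraicIndependent_unmixedPowerSum K n,
    hS, hli, by rw [hspan, range_reynolds]⟩

variable {K n} {S : Set (MvPolynomial (Fin n ⊕ Fin n) K)}

namespace IsHironakaDecomposition

theorem ncard_eq (hS : IsHironakaDecomposition (diagonalInvariants K n) (unmixedPowerSum K n) S) :
    S.ncard = n.factorial := by
  have hr : Set.range (fun x : S => id (x : MvPolynomial (Fin n ⊕ Fin n) K)) = S :=
    Subtype.range_coe
  have h := finrank_mul_finrank_of_coe_eq (powerSumAlgebra K n) (diagonalInvariants K n)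
    (powerSumAlgebra_le_diagonalInvariants K n)
    (Submodule.span _ (Set.range (fun x : S => id (x : MvPolynomial (Fin n ⊕ Fin n) K))))
    (by rw [hr]; exact hS.secondary_span)
  rw [finrank_diagonalInvariants, (finrank_powerSumAlgebra K n).2,
    finrank_eq_nat_card_basis (Basis.span hS.secondary_linearIndependent)] at h
  exact Nat.eq_of_mul_eq_mul_right n.factorial_pos h

/-- Applying the Reynolds operator to g = ∑ c_j θ_j makes the coefficients invariant, hence in the
P-span of S, which contradicts independence. -/
theorem notMem_span (hS : IsHironakaDecomposition (diagonalInvariants K n) (unmixedPowerSum K n) S)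
    {g : MvPolynomial (Fin n ⊕ Fin n) K} (hg : g ∈ S) :
    g ∉ Ideal.span (Set.range (unmixedPowerSum K n)) := by
  intro h
  obtain ⟨c, hc⟩ := Ideal.mem_span_range_iff_exists_fun.1 h
  have hmem : ∀ f, f ∈ diagonalInvariants K n ↔ f ∈ Submodule.span (powerSumAlgebra K n) S :=
    fun f => (Set.ext_iff.1 hS.secondary_span f).symm
  refine sum_smul_ne_of_linearIndepOn (powerSumAlgebra K n) hS.secondary_linearIndependent
    (fun j => ⟨unmixedPowerSum K n j, Algebra.subset_adjoin ⟨j, rfl⟩⟩)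
    (fun j => (unmixedPowerSum_isHomogeneous K n j).coeff_eq_zero
      (by simpa using (unmixedPowerSum_degree_pos n j).ne))
    (fun j => reynolds K n (c j)) (fun j => (hmem _).1 (reynolds_mem K n _)) hg ?_
  rw [← reynolds_eq_self K n ((hmem g).2 (Submodule.subset_span hg))]
  conv_rhs => rw [← hc]
  rw [map_sum]
  refine Finset.sum_congr rfl fun j _ => ?_
  rw [← map_smul, mul_comm]
  rfl

theorem isGreatest_totalDegree
    (hS : IsHironakaDecomposition (diagonalInvariants K n) (unmixedPowerSum K n) S) :
    IsGreatest (totalDegree '' S) (n * (n - 1)) := by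
  constructor
  -- Otherwise the staircase orbit sum would lie in the ideal.
  · by_contra hnot
    have hw := staircaseOrbitSum_mem K n
    rw [← SetLike.mem_coe, ← hS.secondary_span] at hw
    refine staircaseOrbitSum_notMem_span K n <| mem_span_range_of_forall_degree_ne
      (unmixedPowerSum_isHomogeneous K n) (unmixedPowerSum_degree_pos n) _ rfl (fun g hg => ?_) hw
      (staircaseOrbitSum_isHomogeneous K n)
    obtain ⟨d, hd⟩ := hS.secondary_homogeneous g hg
    exact ⟨d, fun h => hnot ⟨g, hg, h ▸ hd.totalDegree (hS.secondary_linearIndependent.ne_zero hg)⟩, hd⟩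
  · rintro _ ⟨g, hg, rfl⟩
    obtain ⟨d, hd⟩ := hS.secondary_homogeneous g hg
    rw [hd.totalDegree (hS.secondary_linearIndependent.ne_zero hg)]
    -- Above degree n(n-1) no spanning monomial has the degree of g, so g would lie in the ideal.
    by_contra! hlt
    refine hS.notMem_span hg <| mem_span_range_of_forall_degree_ne
      (unmixedPowerSum_isHomogeneous K n) (unmixedPowerSum_degree_pos n) _ rfl ?_
      (span_pairMonomial K n ▸ Submodule.mem_top) hd
    rintro _ ⟨p, hp, rfl⟩
    refine ⟨_, ?_, pairMonomial_isHomogeneous K n p⟩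
    obtain ⟨h₁, h₂⟩ := Finset.mem_product.1 hp
    have := sum_le_of_mem_staircase h₁
    have := sum_le_of_mem_staircase h₂
    omega

end IsHironakaDecomposition

end Secondary

theorem mainTheorem6 (K : Type*) [Field K] [CharZero K] (n : ℕ) :
    (∃ S : Set (MvPolynomial (Fin n ⊕ Fin n) K),
      IsHironakaDecomposition (diagonalInvariants K n) (unmixedPowerSum K n) S) ∧
    ∀ S : Set (MvPolynomial (Fin n ⊕ Fin n) K),
      IsHironakaDecomposition (diagonalInvariants K n) (unmixedPowerSum K n) S →
        S.Finite ∧ S.ncard = n.factorial ∧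
          IsGreatest (MvPolynomial.totalDegree '' S) (n * (n - 1)) :=
  ⟨exists_isHironakaDecomposition K n, fun _ hS =>
    -- `Set.ncard` is 0 on infinite sets, so the positive value n! forces finiteness.
    ⟨Set.finite_of_ncard_pos (hS.ncard_eq ▸ n.factorial_pos), hS.ncard_eq,
      hS.isGreatest_totalDegree⟩⟩
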